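/- Let $\mu,\nu$ be Borel probability measures on $\mathbb{R}$ with finite first moments, and assume that $\mu$ has no atoms. Let $\mathbb{P}$ be a left-monotone martingale coupling of $\mu$ and $\nu$; that is, $\mathbb{P}$ is a probability measure on $\mathbb{R}^2$ with marginals $\mu$ and $\nu$ such that the coordinate maps $(X,Y)$ satisfy $\mathbb{E}^{\mathbb{P}}[Y\mid X]=X$ a.s., and there is a Borel set $\Gamma\subset\mathbb{R}^2$ with $\mathbb{P}(\Gamma)=1$ such that $y'\notin(y_0,y_1)$ whenever $(x,y_0),(x,y_1),(x',y')\in\Gamma$ and $x<x'$. Let $T_d,T_u:\mathbb{R}\to\mathbb{R}$ be Borel maps with $T_d(x)\le x\le T_u(x)$ for all $x$, $\{x: T_d(x)=x\}=\{x: T_u(x)=x\}$, and $$\mathbb{P}(dx,dy)=\mu(dx)\big[q(x)\delta_{T_u(x)}+(1-q(x))\delta_{T_d(x)}\big](dy),\qquad q(x)=\frac{x-T_d(x)}{T_u(x)-T_d(x)}\mathbf{1}_{\{T_d(x)<T_u(x)\}}.$$ Let $B=(B_t)_{t\ge0}$ be a Brownian motion with continuous paths relative to a filtration $(\mathcal{F}_t)_{t\ge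 0}$ on some probability space, with $B_0\sim\mu$ (so $B$ is adapted and, for $s\le t$, $B_t-B_s$ is independent of $\mathcal{F}_s$ with law $N(0,t-s)$), and put $$\tau^{\mathbb{P}}:=\inf\{t>0:\ B_t\notin[T_d(B_0),T_u(B_0)]\}.$$ Then $(B_0,B_{\tau^{\mathbb{P}}})$ has law $\mathbb{P}$. Moreover, with respect to the right-continuous filtration $\mathcal{F}_{t+}=\bigcap_{s>t}\mathcal{F}_s$, $\tau^{\mathbb{P}}$ is a minimal embedding of $\nu$: it is an almost surely finite stopping time with $B_{\tau^{\mathbb{P}}}\sim\nu$, and every stopping time $\sigma$ with $\sigma\le\tau^{\mathbb{P}}$ a.s. and $B_\sigma\sim\nu$ satisfies $\sigma=\tau^{\mathbb{P}}$ a.s. -/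

import Mathlib

open MeasureTheory ProbabilityTheory
open scoped NNReal ENNReal

noncomputable section

namespace LeftMonotone

/-- `π` is a martingale coupling of `μ` and `ν`: a probability measure on the plane with marginals
`μ` and `ν` such that `E[Y | X] = X` almost surely, where `(X, Y)` are the coordinates. The
condition is meaningful when `ν` has a finite first moment, so that `Y` is integrable. -/
structure IsMartingaleCoupling (π : Measure (ℝ × ℝ)) (μ ν : Measure ℝ) : Prop where
  isProbabilityMeasure : IsProbabilityMeasure π
  fst_eq : π.fst = μ
  snd_eq : π.snd = ν
  condExp_eq : π[fun z : ℝ × ℝ => z.2 | MeasurableSpace.comap Prod.fst inferInstance]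
    =ᵐ[π] fun z => z.1

/-- `π` is left-monotone: it has a Borel support `Γ` such that, for all `(x, y₀)`, `(x, y₁)`,
`(x', y')` in `Γ` with `x < x'`, the point `y'` does not lie in the open interval `(y₀, y₁)`. -/
def IsLeftMonotone (π : Measure (ℝ × ℝ)) : Prop :=
  ∃ Γ : Set (ℝ × ℝ), MeasurableSet Γ ∧ π Γ = 1 ∧
    ∀ x y₀ y₁ x' y' : ℝ, (x, y₀) ∈ Γ → (x, y₁) ∈ Γ → (x', y') ∈ Γ → x < x' →
      y' ∉ Set.Ioo y₀ y₁

/-- The weight `q(x) = (x - T_d(x)) / (T_u(x) - T_d(x))` where `T_d(x) < T_u(x)`, and `0`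
elsewhere. -/
def upWeight (Td Tu : ℝ → ℝ) (x : ℝ) : ℝ :=
  if Td x < Tu x then (x - Td x) / (Tu x - Td x) else 0

lemma measurable_upWeight {Td Tu : ℝ → ℝ} (hd : Measurable Td) (hu : Measurable Tu) :
    Measurable (upWeight Td Tu) :=
  Measurable.ite (measurableSet_lt hd hu) ((measurable_id.sub hd).div (hu.sub hd))
    measurable_const

/-- The kernel `x ↦ q(x) δ_{T_u(x)} + (1 - q(x)) δ_{T_d(x)}`. -/
def twoPointKernel (Td Tu : ℝ → ℝ) (hd : Measurable Td) (hu : Measurable Tu) : Kernel ℝ ℝ where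
  toFun x := ENNReal.ofReal (upWeight Td Tu x) • Measure.dirac (Tu x)
    + ENNReal.ofReal (1 - upWeight Td Tu x) • Measure.dirac (Td x)
  measurable' := by
    have hq := measurable_upWeight hd hu
    refine Measure.measurable_of_measurable_coe _ fun s hs => ?_
    simp only [Measure.coe_add, Measure.coe_smul, Pi.add_apply, Pi.smul_apply, smul_eq_mul]
    exact (hq.ennreal_ofReal.mul ((Measure.measurable_coe hs).comp
      (Measure.measurable_dirac.comp hu))).add
      ((measurable_const.sub hq).ennreal_ofReal.mul ((Measure.measurable_coe hs).comp
      (Measure.measurable_dirac.comp hd)))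

/-- `(T_d, T_u)` is a pair of maps on whose graphs the coupling `π` with first marginal `μ` is
concentrated: `T_d(x) ≤ x ≤ T_u(x)`, `T_d(x) = x` exactly when `T_u(x) = x`, and
`π(dx, dy) = μ(dx) [q(x) δ_{T_u(x)} + (1 - q(x)) δ_{T_d(x)}](dy)`. -/
structure IsTransportPair (π : Measure (ℝ × ℝ)) (μ : Measure ℝ) (Td Tu : ℝ → ℝ) : Prop where
  measurable_down : Measurable Td
  measurable_up : Measurable Tu
  down_le : ∀ x, Td x ≤ x
  le_up : ∀ x, x ≤ Tu x
  down_eq_iff : ∀ x, Td x = x ↔ Tu x = x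
  eq_compProd : π = μ ⊗ₘ twoPointKernel Td Tu measurable_down measurable_up

/-- `B` is a (continuous, real-valued) Brownian motion relative to the filtration `𝓕`, started
from `B 0 ∼ μ`. -/
structure IsBrownianFrom {Ω : Type*} {m : MeasurableSpace Ω} (𝓕 : Filtration ℝ≥0 m)
    (B : ℝ≥0 → Ω → ℝ) (μ : Measure ℝ) (P : Measure Ω) : Prop where
  adapted : StronglyAdapted 𝓕 B
  continuous_paths : ∀ ω, Continuous fun t => B t ω
  hasLaw_zero : HasLaw (B 0) μ P
  hasLaw_increment : ∀ s t, s ≤ t →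
    HasLaw (fun ω => B t ω - B s ω) (gaussianReal 0 (t - s)) P
  indep_increment : ∀ s t, s ≤ t →
    Indep (MeasurableSpace.comap (fun ω => B t ω - B s ω) inferInstance) (𝓕 s) P

/-- The first exit time `inf {t > 0 : B_t ∉ [T_d(B_0), T_u(B_0)]}`, with `inf ∅ = ∞`. -/
def exitTime {Ω : Type*} (B : ℝ≥0 → Ω → ℝ) (Td Tu : ℝ → ℝ) (ω : Ω) : WithTop ℝ≥0 :=
  sInf ((fun t : ℝ≥0 => (t : WithTop ℝ≥0)) ''
    {t : ℝ≥0 | 0 < t ∧ B t ω ∉ Set.Icc (Td (B 0 ω)) (Tu (B 0 ω))})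

/-- `τ` is a solution of the Skorokhod embedding problem for `ν`: an almost surely finite stopping
time with `B_τ ∼ ν`. -/
structure Embeds {Ω : Type*} {m : MeasurableSpace Ω} (𝓕 : Filtration ℝ≥0 m)
    (B : ℝ≥0 → Ω → ℝ) (ν : Measure ℝ) (P : Measure Ω) (τ : Ω → WithTop ℝ≥0) : Prop where
  isStoppingTime : IsStoppingTime 𝓕 τ
  ae_ne_top : ∀ᵐ ω ∂P, τ ω ≠ ⊤
  hasLaw : HasLaw (stoppedValue B τ) ν P

/-- `τ` is a minimal embedding of `ν`: it embeds `ν`, and every stopping time `σ ≤ τ` which embeds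
`ν` is almost surely equal to `τ`. -/
def IsMinimalEmbedding {Ω : Type*} {m : MeasurableSpace Ω} (𝓕 : Filtration ℝ≥0 m)
    (B : ℝ≥0 → Ω → ℝ) (ν : Measure ℝ) (P : Measure Ω) (τ : Ω → WithTop ℝ≥0) : Prop :=
  Embeds 𝓕 B ν P τ ∧
    ∀ σ : Ω → WithTop ℝ≥0, Embeds 𝓕 B ν P σ → (∀ᵐ ω ∂P, σ ω ≤ τ ω) → σ =ᵐ[P] τ

end LeftMonotone

end

/-! Given `B 0 = x`, the path almost surely leaves the interval from `Td x` to `Tu x`, and by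
continuity it does so at an endpoint. Until then it is a bounded martingale, so it exits at `Tu x`
with probability `upWeight Td Tu x`, the only weight on the two endpoints with barycentre `x`.
Integration over `μ` gives the law `π`. Instead of conditioning on `B 0`, the argument tests
optional sampling against bounded functions of `B 0` supported where the interval length is bounded
(`integral_mul_stoppedValue_sub`), and then exhausts the line (`measure_exitUp_inter`,
`hasLaw_exit`).

Minimality has two steps. Let `σ ≤ τ` embed the same law, where `τ` is the exit time. For the
strictly convex function `φ y = √(1 + y ^ 2)`, the gap between `φ (B_τ)` and the tangent of `φ` at
`B_σ`, evaluated at `B_τ`, is nonnegative. Its mean is zero, because the laws agree and `E[φ'(B_σ)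
(B_τ - B_σ)] = 0`. Strict convexity then forces `B_σ = B_τ` almost surely (`ae_stoppedValue_eq`).
Next, the martingale `(B_t - B_0) ^ 2 - t` turns equality of the values into equality of the times:
on an initial event with bounded intervals, the mean of `τ ∧ N - σ ∧ N` tends to zero as `N` grows
(`ae_eq_exitTime_of_stoppedValue_eq`). -/

namespace LeftMonotone

open Filter Topology

/-! ### Optional sampling for continuous martingales at bounded optional times. -/

section OptionalSampling

variable {Ω : Type*} {m : MeasurableSpace Ω}

/-- The first point of the grid `(k + 1)⁻¹ ℕ` strictly after the time `t`. -/
noncomputable def gridAfter (k : ℕ) (t : ℝ≥0) : ℝ≥0 := (⌊((k : ℝ≥0) + 1) * t⌋₊ + 1) / ((k : ℝ≥0) + 1)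

lemma le_gridAfter (k : ℕ) (t : ℝ≥0) : t ≤ gridAfter k t := by
  rw [gridAfter, le_div_iff₀ (by positivity), mul_comm]
  exact (Nat.lt_floor_add_one _).le

lemma gridAfter_le (k : ℕ) (t : ℝ≥0) : gridAfter k t ≤ t + 1 / ((k : ℝ≥0) + 1) := by
  rw [gridAfter, div_le_iff₀ (by positivity), add_mul t, one_div, inv_mul_cancel₀ (by positivity),
    mul_comm t]
  gcongr
  exact Nat.floor_le (by positivity)

lemma gridAfter_le_add_one (k : ℕ) (t : ℝ≥0) : gridAfter k t ≤ t + 1 := by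
  refine (gridAfter_le k t).trans ?_
  gcongr
  rw [div_le_one (by positivity)]
  exact le_add_self

lemma gridAfter_mono (k : ℕ) : Monotone (gridAfter k) := by
  intro s t h
  unfold gridAfter
  gcongr

lemma tendsto_gridAfter (t : ℝ≥0) : Tendsto (fun k => gridAfter k t) atTop (𝓝 t) := by
  refine tendsto_of_tendsto_of_tendsto_of_le_of_le tendsto_const_nhds ?_
    (fun k => le_gridAfter k t) (fun k => gridAfter_le k t)
  simpa using (tendsto_const_nhds (x := t)).add (tendsto_one_div_add_atTop_nhds_zero_nat (𝕜 := ℝ≥0))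

/-- Since the grid point is strictly after `T`, it is at most `t` exactly when `T` is strictly below
some positive grid point not exceeding `t`. Events of the form `T < s` therefore suffice, which is
all that an optional time provides. -/
lemma isStoppingTime_gridAfter {𝓕 : Filtration ℝ≥0 m} {T : Ω → ℝ≥0}
    (hT : ∀ t, MeasurableSet[𝓕 t] {ω | T ω < t}) (k : ℕ) :
    IsStoppingTime 𝓕 (fun ω => (gridAfter k (T ω) : WithTop ℝ≥0)) := by
  intro t
  have h : {ω | (gridAfter k (T ω) : WithTop ℝ≥0) ≤ t}
      = ⋃ j : ℕ, ⋃ _ : ((j : ℝ≥0) + 1) / ((k : ℝ≥0) + 1) ≤ t,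
        {ω | T ω < ((j : ℝ≥0) + 1) / ((k : ℝ≥0) + 1)} := by
    ext ω
    simp only [Set.mem_ofPred_eq, WithTop.coe_le_coe, Set.mem_iUnion, exists_prop]
    constructor
    · intro h
      refine ⟨_, h, ?_⟩
      rw [lt_div_iff₀ (by positivity), mul_comm]
      exact Nat.lt_floor_add_one _
    · rintro ⟨j, hj, hlt⟩
      refine le_trans ?_ hj
      rw [lt_div_iff₀ (by positivity), mul_comm] at hlt
      unfold gridAfter
      gcongr
      rw [← Nat.lt_add_one_iff, Nat.floor_lt (by positivity)]
      exact_mod_cast hlt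
  rw [h]
  exact MeasurableSet.iUnion fun j => MeasurableSet.iUnion fun hj => 𝓕.mono hj _ (hT _)

lemma countable_range_gridAfter (k : ℕ) (T : Ω → ℝ≥0) :
    (Set.range fun ω => (gridAfter k (T ω) : WithTop ℝ≥0)).Countable := by
  refine (Set.countable_range
    fun j : ℕ => (((j + 1 : ℝ≥0) / (k + 1) : ℝ≥0) : WithTop ℝ≥0)).mono ?_
  rintro _ ⟨ω, rfl⟩
  exact ⟨⌊((k : ℝ≥0) + 1) * T ω⌋₊, rfl⟩

variable {P : Measure Ω} [IsProbabilityMeasure P] {𝓕 : Filtration ℝ≥0 m} {M G : ℝ≥0 → Ω → ℝ}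
  {S T : Ω → ℝ≥0} {N : ℝ≥0}

/-- On the grid, the stopped values are conditional expectations of the single variable `M (N + 1)`,
hence uniformly integrable. Pathwise convergence then upgrades to convergence in `L¹`. -/
lemma integrable_and_tendsto_gridAfter (hM : Martingale M 𝓕 P)
    (hMc : ∀ ω, Continuous fun t => M t ω) (hT : ∀ t, MeasurableSet[𝓕 t] {ω | T ω < t})
    (hTN : ∀ ω, T ω ≤ N) :
    Integrable (fun ω => M (T ω) ω) P ∧
      (∀ k, Integrable (fun ω => M (gridAfter k (T ω)) ω) P) ∧
      Tendsto (fun k => ∫ ω, |M (gridAfter k (T ω)) ω - M (T ω) ω| ∂P) atTop (𝓝 0) := by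
  have hst := isStoppingTime_gridAfter hT
  -- Rounding up overshoots by at most one, so `N + 1` bounds all grid times.
  have hle : ∀ k ω, (gridAfter k (T ω) : WithTop ℝ≥0) ≤ ((N + 1 : ℝ≥0) : WithTop ℝ≥0) := by
    intro k ω
    exact_mod_cast (gridAfter_le_add_one k _).trans (by gcongr; exact hTN ω)
  have heq : ∀ k, (fun ω => M (gridAfter k (T ω)) ω) =ᵐ[P]
      P[M (N + 1) | (hst k).measurableSpace] := fun k =>
    hM.stoppedValue_ae_eq_condExp_of_le_const_of_countable_range (hst k) (hle k)
      (countable_range_gridAfter k T)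
  have hui := (hM.integrable (N + 1)).uniformIntegrable_condExp
    (ℱ := fun k => (hst k).measurableSpace) fun k => (hst k).measurableSpace_le
  have hint : ∀ k, Integrable (fun ω => M (gridAfter k (T ω)) ω) P := fun k =>
    integrable_condExp.congr (heq k).symm
  have hlim : ∀ ω, Tendsto (fun k => M (gridAfter k (T ω)) ω) atTop (𝓝 (M (T ω) ω)) := fun ω =>
    ((hMc ω).tendsto _).comp (tendsto_gridAfter _)
  have hui' : UniformIntegrable (fun k ω => M (gridAfter k (T ω)) ω) 1 P :=
    hui.ae_eq fun k => (heq k).symm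
  have hmem : MemLp (fun ω => M (T ω) ω) 1 P :=
    hui'.memLp_of_ae_tendsto (Eventually.of_forall hlim)
  have hL := tendsto_Lp_finite_of_tendsto_ae le_rfl ENNReal.one_ne_top
    (fun k => (hint k).aestronglyMeasurable) hmem hui'.2.1 (Eventually.of_forall hlim)
  refine ⟨hmem.integrable le_rfl, hint, ?_⟩
  have h2 := (ENNReal.tendsto_toReal ENNReal.zero_ne_top).comp hL
  refine h2.congr fun k => ?_
  simp only [Function.comp, eLpNorm_one_eq_lintegral_enorm]
  rw [← integral_norm_eq_lintegral_enorm
    ((hint k).sub (hmem.integrable le_rfl)).aestronglyMeasurable]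
  rfl

/-- Optional sampling for a continuous martingale `M` between two bounded optional times, tested
against the value of a bounded continuous adapted process at the earlier time. -/
theorem integral_mul_sub_eq_zero (hM : Martingale M 𝓕 P)
    (hMc : ∀ ω, Continuous fun t => M t ω) (hG : StronglyAdapted 𝓕 G)
    (hGc : ∀ ω, Continuous fun t => G t ω) {C : ℝ} (hGC : ∀ t ω, |G t ω| ≤ C)
    (hS : ∀ t, MeasurableSet[𝓕 t] {ω | S ω < t}) (hT : ∀ t, MeasurableSet[𝓕 t] {ω | T ω < t})
    (hST : ∀ ω, S ω ≤ T ω) (hTN : ∀ ω, T ω ≤ N) :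
    ∫ ω, G (S ω) ω * (M (T ω) ω - M (S ω) ω) ∂P = 0 := by
  have hSN : ∀ ω, S ω ≤ N := fun ω => (hST ω).trans (hTN ω)
  obtain ⟨iS, iSk, lS⟩ := integrable_and_tendsto_gridAfter hM hMc hS hSN
  obtain ⟨iT, iTk, lT⟩ := integrable_and_tendsto_gridAfter hM hMc hT hTN
  have sS := isStoppingTime_gridAfter hS
  have sT := isStoppingTime_gridAfter hT
  have hGp := hG.isStronglyProgressive_of_continuous hGc
  have hGk : ∀ k, StronglyMeasurable[(sS k).measurableSpace]
      (fun ω => G (gridAfter k (S ω)) ω) := fun k =>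
    (measurable_stoppedValue hGp (sS k)).stronglyMeasurable
  have hGk' : ∀ k, AEStronglyMeasurable (fun ω => G (gridAfter k (S ω)) ω) P := fun k =>
    ((hGk k).mono (sS k).measurableSpace_le).aestronglyMeasurable
  have hGlim : ∀ ω, Tendsto (fun k => G (gridAfter k (S ω)) ω) atTop (𝓝 (G (S ω) ω)) := fun ω =>
    ((hGc ω).tendsto _).comp (tendsto_gridAfter _)
  have zero : ∀ k, ∫ ω, G (gridAfter k (S ω)) ω *
      (M (gridAfter k (T ω)) ω - M (gridAfter k (S ω)) ω) ∂P = 0 := by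
    intro k
    have hle : ∀ ω, (gridAfter k (T ω) : WithTop ℝ≥0) ≤ ((N + 1 : ℝ≥0) : WithTop ℝ≥0) := by
      intro ω
      exact_mod_cast (gridAfter_le_add_one k _).trans (by gcongr; exact hTN ω)
    have hce : (fun ω => M (gridAfter k (S ω)) ω) =ᵐ[P]
        P[fun ω => M (gridAfter k (T ω)) ω | (sS k).measurableSpace] :=
      hM.stoppedValue_ae_eq_condExp_of_le_of_countable_range (sT k) (sS k)
        (fun ω => WithTop.coe_le_coe.2 (gridAfter_mono k (hST ω))) hle
        (countable_range_gridAfter k T) (countable_range_gridAfter k S)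
    have hmul := condExp_stronglyMeasurable_mul_of_bound (sS k).measurableSpace_le (hGk k) (iTk k)
      C (Eventually.of_forall fun ω => hGC _ ω)
    have e1 : ∫ ω, G (gridAfter k (S ω)) ω * M (gridAfter k (T ω)) ω ∂P
        = ∫ ω, G (gridAfter k (S ω)) ω * M (gridAfter k (S ω)) ω ∂P := by
      have := integral_condExp (μ := P) (f := (fun ω => G (gridAfter k (S ω)) ω) *
        (fun ω => M (gridAfter k (T ω)) ω)) (sS k).measurableSpace_le
      refine this.symm.trans (integral_congr_ae ?_)
      filter_upwards [hmul, hce] with ω h1 h2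
      rw [h1, Pi.mul_apply, ← h2]
    simp only [mul_sub]
    rw [integral_sub ((iTk k).bdd_mul (hGk' k) (Eventually.of_forall fun ω => hGC _ ω))
      ((iSk k).bdd_mul (hGk' k) (Eventually.of_forall fun ω => hGC _ ω)), e1, sub_self]
  have iD : Integrable (fun ω => M (T ω) ω - M (S ω) ω) P := iT.sub iS
  -- The same integrals have two limits: the target, by dominated convergence with `M` frozen at the
  -- true times, and zero, by replacing these by grid times at an `L¹` cost.
  have l1 : Tendsto (fun k => ∫ ω, G (gridAfter k (S ω)) ω * (M (T ω) ω - M (S ω) ω) ∂P) atTop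
      (𝓝 (∫ ω, G (S ω) ω * (M (T ω) ω - M (S ω) ω) ∂P)) := by
    refine tendsto_integral_of_dominated_convergence
      (fun ω => C * |M (T ω) ω - M (S ω) ω|) (fun k => (hGk' k).mul iD.aestronglyMeasurable)
      (iD.abs.const_mul C) (fun k => Eventually.of_forall fun ω => ?_)
      (Eventually.of_forall fun ω => (hGlim ω).mul_const _)
    rw [Real.norm_eq_abs, abs_mul]
    gcongr
    exact hGC _ _
  have l2 : Tendsto (fun k => ∫ ω, G (gridAfter k (S ω)) ω * (M (T ω) ω - M (S ω) ω) ∂P) atTop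
      (𝓝 0) := by
    have hb : Tendsto (fun k => C * (∫ ω, |M (gridAfter k (T ω)) ω - M (T ω) ω| ∂P
        + ∫ ω, |M (gridAfter k (S ω)) ω - M (S ω) ω| ∂P)) atTop (𝓝 0) := by
      simpa using (lT.add lS).const_mul C
    refine squeeze_zero_norm (fun k => ?_) hb
    have iDk : Integrable (fun ω => M (gridAfter k (T ω)) ω - M (gridAfter k (S ω)) ω) P :=
      (iTk k).sub (iSk k)
    have e : ∫ ω, G (gridAfter k (S ω)) ω * (M (T ω) ω - M (S ω) ω) ∂P
        = ∫ ω, G (gridAfter k (S ω)) ω * ((M (T ω) ω - M (S ω) ω)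
          - (M (gridAfter k (T ω)) ω - M (gridAfter k (S ω)) ω)) ∂P := by
      simp only [mul_sub _ (M _ _ - M _ _) (M _ _ - M _ _)]
      rw [integral_sub (iD.bdd_mul (hGk' k) (Eventually.of_forall fun ω => hGC _ ω))
        (iDk.bdd_mul (hGk' k) (Eventually.of_forall fun ω => hGC _ ω)), zero, sub_zero]
    have jT : Integrable (fun ω => |M (gridAfter k (T ω)) ω - M (T ω) ω|) P :=
      ((iTk k).sub iT).abs
    have jS : Integrable (fun ω => |M (gridAfter k (S ω)) ω - M (S ω) ω|) P :=
      ((iSk k).sub iS).abs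
    rw [e, ← integral_add jT jS, ← integral_const_mul]
    refine norm_integral_le_of_norm_le ((jT.add jS).const_mul C) (Eventually.of_forall fun ω => ?_)
    rw [Real.norm_eq_abs, abs_mul]
    refine mul_le_mul (hGC _ _) ?_ (abs_nonneg _) ((abs_nonneg _).trans (hGC 0 ω))
    grind
  exact tendsto_nhds_unique l1 l2

end OptionalSampling

/-! ### Martingales of Brownian motion, and properties of the exit time. -/

section Brownian

variable {Ω : Type*} {m : MeasurableSpace Ω} {P : Measure Ω}
  {𝓕 : Filtration ℝ≥0 m} {B : ℝ≥0 → Ω → ℝ} {μ : Measure ℝ} {Td Tu : ℝ → ℝ}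

namespace IsBrownianFrom

lemma measurable (hB : IsBrownianFrom 𝓕 B μ P) (t : ℝ≥0) : Measurable (B t) :=
  (hB.adapted t).measurable.mono (𝓕.le t) le_rfl

lemma stronglyAdapted_sub_zero (hB : IsBrownianFrom 𝓕 B μ P) :
    StronglyAdapted 𝓕 (fun t ω => B t ω - B 0 ω) := fun t =>
  (hB.adapted t).sub ((hB.adapted 0).mono (𝓕.mono zero_le))

lemma continuous_sub_zero (hB : IsBrownianFrom 𝓕 B μ P) (ω : Ω) :
    Continuous fun t => B t ω - B 0 ω :=
  (hB.continuous_paths ω).sub continuous_const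

lemma memLp_increment (hB : IsBrownianFrom 𝓕 B μ P) {s t : ℝ≥0} (h : s ≤ t) :
    MemLp (fun ω => B t ω - B s ω) 2 P := by
  have hl := hB.hasLaw_increment s t h
  have := memLp_id_gaussianReal' (μ := 0) (v := t - s) 2 (by simp)
  rw [← hl.map_eq, memLp_map_measure_iff aestronglyMeasurable_id hl.aemeasurable] at this
  exact this

lemma integral_increment (hB : IsBrownianFrom 𝓕 B μ P) {s t : ℝ≥0} (h : s ≤ t) :
    ∫ ω, (B t ω - B s ω) ∂P = 0 := by
  rw [(hB.hasLaw_increment s t h).integral_eq, integral_id_gaussianReal]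

lemma integral_increment_sq (hB : IsBrownianFrom 𝓕 B μ P) {s t : ℝ≥0} (h : s ≤ t) :
    ∫ ω, (B t ω - B s ω) ^ 2 ∂P = t - s := by
  have hl := hB.hasLaw_increment s t h
  have hv := hl.variance_eq
  rw [variance_id_gaussianReal, variance_of_integral_eq_zero hl.aemeasurable
    (hB.integral_increment h)] at hv
  rw [hv, NNReal.coe_sub h]

lemma condExp_increment [IsProbabilityMeasure P] (hB : IsBrownianFrom 𝓕 B μ P) {s t : ℝ≥0} (h : s ≤ t) :
    P[fun ω => B t ω - B s ω | 𝓕 s] =ᵐ[P] fun _ => 0 := by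
  have hm : Measurable fun ω => B t ω - B s ω := (hB.measurable t).sub (hB.measurable s)
  have := condExp_indep_eq hm.comap_le (𝓕.le s) (comap_measurable _).stronglyMeasurable
    (hB.indep_increment s t h)
  rwa [hB.integral_increment h] at this

lemma condExp_increment_sq [IsProbabilityMeasure P] (hB : IsBrownianFrom 𝓕 B μ P) {s t : ℝ≥0} (h : s ≤ t) :
    P[fun ω => (B t ω - B s ω) ^ 2 | 𝓕 s] =ᵐ[P] fun _ => (t : ℝ) - s := by
  have hm : Measurable fun ω => B t ω - B s ω := (hB.measurable t).sub (hB.measurable s)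
  have := condExp_indep_eq hm.comap_le (𝓕.le s)
    ((comap_measurable (fun ω => B t ω - B s ω)).pow_const 2).stronglyMeasurable
    (hB.indep_increment s t h)
  rwa [hB.integral_increment_sq h] at this

theorem martingale_sub_zero [IsProbabilityMeasure P] (hB : IsBrownianFrom 𝓕 B μ P) :
    Martingale (fun t ω => B t ω - B 0 ω) 𝓕 P := by
  refine ⟨hB.stronglyAdapted_sub_zero, fun s t h => ?_⟩
  have hint : ∀ t, Integrable (fun ω => B t ω - B 0 ω) P := fun t =>
    (hB.memLp_increment zero_le).integrable (by norm_num)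
  have e : (fun ω => B t ω - B 0 ω) = (fun ω => B t ω - B s ω) + fun ω => B s ω - B 0 ω := by
    ext ω; simp
  change P[fun ω => B t ω - B 0 ω | 𝓕 s] =ᵐ[P] fun ω => B s ω - B 0 ω
  rw [e]
  refine (condExp_add ((hB.memLp_increment h).integrable (by norm_num)) (hint s) _).trans ?_
  rw [condExp_of_stronglyMeasurable (𝓕.le s) (hB.stronglyAdapted_sub_zero s) (hint s)]
  filter_upwards [hB.condExp_increment h] with ω hω
  simp [hω]

/-- With `W = B - B 0`, one has `W_t² = (W_t - W_s)² + 2 W_s (W_t - W_s) + W_s²`; given the past,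
the first term has mean `t - s` and the second has mean zero. Removing `B 0` matters because the
starting law need not have a second moment. -/
theorem martingale_sq_sub [IsProbabilityMeasure P] (hB : IsBrownianFrom 𝓕 B μ P) :
    Martingale (fun t ω => (B t ω - B 0 ω) ^ 2 - (t : ℝ)) 𝓕 P := by
  have hW := hB.stronglyAdapted_sub_zero
  have hV : StronglyAdapted 𝓕 (fun t ω => (B t ω - B 0 ω) ^ 2 - (t : ℝ)) := fun t =>
    ((hW t).pow 2).sub stronglyMeasurable_const
  refine ⟨hV, fun s t h => ?_⟩
  have hint : ∀ t : ℝ≥0, Integrable (fun ω => (B t ω - B 0 ω) ^ 2 - (t : ℝ)) P := fun t =>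
    (hB.memLp_increment zero_le).integrable_sq.sub (integrable_const _)
  have hW2 : StronglyMeasurable[𝓕 s] (fun ω => 2 * (B s ω - B 0 ω)) := (hW s).const_mul 2
  have hI := (hB.memLp_increment h).integrable (q := 2) (by norm_num)
  have hprod : Integrable ((fun ω => 2 * (B s ω - B 0 ω)) * fun ω => B t ω - B s ω) P :=
    ((hB.memLp_increment zero_le).const_mul 2).integrable_mul (hB.memLp_increment h)
  have hsq : Integrable (fun ω => (B t ω - B s ω) ^ 2) P := (hB.memLp_increment h).integrable_sq
  have e : (fun ω => (B t ω - B 0 ω) ^ 2 - (t : ℝ)) = ((fun ω => (B t ω - B s ω) ^ 2)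
      + (fun ω => 2 * (B s ω - B 0 ω)) * fun ω => B t ω - B s ω)
      + fun ω => (B s ω - B 0 ω) ^ 2 - (t : ℝ) := by
    ext ω; simp only [Pi.add_apply, Pi.mul_apply]; ring
  have hlast : Integrable (fun ω => (B s ω - B 0 ω) ^ 2 - (t : ℝ)) P :=
    (hB.memLp_increment zero_le).integrable_sq.sub (integrable_const _)
  change P[fun ω => (B t ω - B 0 ω) ^ 2 - (t : ℝ) | 𝓕 s] =ᵐ[P]
    fun ω => (B s ω - B 0 ω) ^ 2 - (s : ℝ)
  have hlast' : StronglyMeasurable[𝓕 s] (fun ω => (B s ω - B 0 ω) ^ 2 - (t : ℝ)) :=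
    ((hW s).pow 2).sub stronglyMeasurable_const
  rw [e]
  refine (condExp_add (hsq.add hprod) hlast _).trans ?_
  rw [condExp_of_stronglyMeasurable (𝓕.le s) hlast' hlast]
  filter_upwards [condExp_add hsq hprod (𝓕 s), hB.condExp_increment_sq h, hB.condExp_increment h,
    condExp_mul_of_stronglyMeasurable_left hW2 hprod hI] with ω h1 h2 h3 h4
  simp only [Pi.add_apply, h1, h2, h4, Pi.mul_apply, h3]
  ring

end IsBrownianFrom

lemma exitTime_le_coe {ω : Ω} {t : ℝ≥0} (ht : 0 < t)
    (h : B t ω ∉ Set.Icc (Td (B 0 ω)) (Tu (B 0 ω))) : exitTime B Td Tu ω ≤ t :=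
  sInf_le ⟨t, ⟨ht, h⟩, rfl⟩

lemma exitTime_lt_iff {ω : Ω} {t : ℝ≥0} : exitTime B Td Tu ω < t ↔
    ∃ s : ℝ≥0, 0 < s ∧ s < t ∧ B s ω ∉ Set.Icc (Td (B 0 ω)) (Tu (B 0 ω)) := by
  rw [exitTime, sInf_lt_iff]
  simp only [Set.exists_mem_image, Set.mem_ofPred_eq, WithTop.coe_lt_coe]
  exact ⟨fun ⟨s, ⟨h1, h2⟩, h3⟩ => ⟨s, h1, h3, h2⟩, fun ⟨s, h1, h3, h2⟩ => ⟨s, ⟨h1, h2⟩, h3⟩⟩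

/-- Before `t` the path stays in the interval by definition of the infimum; closedness and
continuity carry this to `t` itself. -/
lemma mem_Icc_of_le_exitTime (hc : ∀ ω, Continuous fun t => B t ω) (hd : ∀ x, Td x ≤ x)
    (hu : ∀ x, x ≤ Tu x) {ω : Ω} {t : ℝ≥0} (h : (t : WithTop ℝ≥0) ≤ exitTime B Td Tu ω) :
    B t ω ∈ Set.Icc (Td (B 0 ω)) (Tu (B 0 ω)) := by
  rcases eq_or_ne t 0 with rfl | ht
  · exact ⟨hd _, hu _⟩
  have hsub : Set.Iio t ⊆ (fun t => B t ω) ⁻¹' Set.Icc (Td (B 0 ω)) (Tu (B 0 ω)) := by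
    intro s hs
    rcases eq_or_ne s 0 with rfl | hs0
    · exact ⟨hd _, hu _⟩
    by_contra hcon
    have h1 := h.trans (exitTime_le_coe (pos_iff_ne_zero.2 hs0) hcon)
    exact absurd (WithTop.coe_le_coe.1 h1) (not_le.2 hs)
  have hcl := closure_minimal hsub (isClosed_Icc.preimage (hc ω))
  rw [closure_Iio' ⟨0, pos_iff_ne_zero.2 ht⟩] at hcl
  exact hcl (Set.mem_Iic.2 le_rfl)

/-- From an interior point the path would stay inside for a little longer, so the infimum would be
later. -/
lemma eq_or_eq_of_exitTime_eq (hc : ∀ ω, Continuous fun t => B t ω) (hd : ∀ x, Td x ≤ x)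
    (hu : ∀ x, x ≤ Tu x) {ω : Ω} {t : ℝ≥0} (h : exitTime B Td Tu ω = t) :
    B t ω = Tu (B 0 ω) ∨ B t ω = Td (B 0 ω) := by
  by_contra! hcon
  have hmem := mem_Icc_of_le_exitTime hc hd hu h.ge
  have hIoo : B t ω ∈ Set.Ioo (Td (B 0 ω)) (Tu (B 0 ω)) :=
    ⟨lt_of_le_of_ne hmem.1 hcon.2.symm, lt_of_le_of_ne hmem.2 hcon.1⟩
  have hnear : ∀ᶠ s in 𝓝 t, B s ω ∈ Set.Ioo (Td (B 0 ω)) (Tu (B 0 ω)) :=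
    (hc ω).continuousAt.eventually (isOpen_Ioo.mem_nhds hIoo)
  obtain ⟨u, htu, hu'⟩ := exists_Ico_subset_of_mem_nhds hnear ⟨t + 1, lt_add_one t⟩
  have hlt : exitTime B Td Tu ω < u := by rw [h]; exact_mod_cast htu
  obtain ⟨s, hs0, hsu, hs⟩ := exitTime_lt_iff.1 hlt
  have hts : t ≤ s := by exact_mod_cast h.ge.trans (exitTime_le_coe hs0 hs)
  exact hs (Set.Ioo_subset_Icc_self (hu' ⟨hts, hsu⟩))

/-- The times in `(0, t)` at which the path is outside form an open set, so countably many dense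
times detect an exit. -/
theorem measurableSet_exitTime_lt (hB : IsBrownianFrom 𝓕 B μ P) (hTd : Measurable Td)
    (hTu : Measurable Tu) (t : ℝ≥0) : MeasurableSet[𝓕 t] {ω | exitTime B Td Tu ω < t} := by
  obtain ⟨D, hDc, hDd⟩ := TopologicalSpace.exists_countable_dense ℝ≥0
  have h : {ω | exitTime B Td Tu ω < t} = ⋃ s ∈ D ∩ Set.Ioo 0 t,
      {ω | B s ω ∈ Set.Icc (Td (B 0 ω)) (Tu (B 0 ω))}ᶜ := by
    ext ω
    simp only [Set.mem_ofPred_eq, exitTime_lt_iff, Set.mem_iUnion, Set.mem_compl_iff, exists_prop]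
    constructor
    · rintro ⟨s, hs0, hst, hs⟩
      have ho : IsOpen (Set.Ioo 0 t ∩ (fun t => B t ω) ⁻¹'
          (Set.Icc (Td (B 0 ω)) (Tu (B 0 ω)))ᶜ) :=
        isOpen_Ioo.inter (isClosed_Icc.isOpen_compl.preimage (hB.continuous_paths ω))
      obtain ⟨r, hr, hrD⟩ := hDd.inter_open_nonempty _ ho ⟨s, ⟨hs0, hst⟩, hs⟩
      exact ⟨r, ⟨hrD, hr.1⟩, hr.2⟩
    · rintro ⟨s, ⟨-, hs⟩, h⟩
      exact ⟨s, hs.1, hs.2, h⟩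
  rw [h]
  refine MeasurableSet.biUnion (hDc.mono Set.inter_subset_left) fun s hs => MeasurableSet.compl ?_
  have h0 : Measurable[𝓕 t] (B 0) := (hB.adapted 0).measurable.mono (𝓕.mono zero_le) le_rfl
  have h1 : Measurable[𝓕 t] (B s) :=
    (hB.adapted s).measurable.mono (𝓕.mono hs.2.2.le) le_rfl
  exact (measurableSet_le (hTd.comp h0) h1).inter (measurableSet_le h1 (hTu.comp h0))

theorem isStoppingTime_exitTime (hB : IsBrownianFrom 𝓕 B μ P) (hTd : Measurable Td)
    (hTu : Measurable Tu) : IsStoppingTime 𝓕.rightCont (exitTime B Td Tu) :=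
  isStoppingTime_of_measurableSet_lt_of_isRightContinuous fun t =>
    𝓕.le_rightCont t _ (measurableSet_exitTime_lt hB hTd hTu t)

/-- An optional time, that is, a stopping time of the right-continuous filtration, is strictly
smaller than `t` on an event of `𝓕 t`. -/
lemma measurableSet_lt_of_rightCont {τ : Ω → WithTop ℝ≥0} (hτ : IsStoppingTime 𝓕.rightCont τ)
    (t : ℝ≥0) : MeasurableSet[𝓕 t] {ω | τ ω < t} := by
  obtain ⟨D, hDc, hDd⟩ := TopologicalSpace.exists_countable_dense ℝ≥0
  have h : {ω | τ ω < t} = ⋃ s ∈ D ∩ Set.Iio t, {ω | τ ω ≤ s} := by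
    ext ω
    simp only [Set.mem_ofPred_eq, Set.mem_iUnion, exists_prop]
    constructor
    · intro h
      obtain ⟨a, ha⟩ := WithTop.ne_top_iff_exists.1 h.ne_top
      rw [← ha, WithTop.coe_lt_coe] at h
      obtain ⟨r, hrD, hr⟩ := hDd.exists_between h
      exact ⟨r, ⟨hrD, hr.2⟩, by rw [← ha]; exact_mod_cast hr.1.le⟩
    · rintro ⟨s, ⟨-, hs⟩, h⟩
      exact h.trans_lt (by exact_mod_cast hs)
  rw [h]
  refine MeasurableSet.biUnion (hDc.mono Set.inter_subset_left) fun s hs => ?_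
  have h2 := hτ s
  rw [Filtration.rightCont_eq] at h2
  have h3 : (⨅ j > s, 𝓕 j) ≤ 𝓕 t := iInf₂_le t hs.2
  exact h3 _ h2

/-- A Brownian motion almost surely leaves the interval: `exitTime` is finite. -/
theorem ae_exitTime_ne_top (hB : IsBrownianFrom 𝓕 B μ P) (hd : ∀ x, Td x ≤ x)
    (hu : ∀ x, x ≤ Tu x) : ∀ᵐ ω ∂P, exitTime B Td Tu ω ≠ ⊤ := by
  have key : ∀ c : ℕ, P (⋂ t : ℝ≥0, {ω | |B t ω - B 0 ω| ≤ c}) = 0 := by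
    intro c
    have hle : ∀ n : ℕ, P (⋂ t : ℝ≥0, {ω | |B t ω - B 0 ω| ≤ c})
        ≤ ENNReal.ofReal ((√(2 * Real.pi))⁻¹ * (2 * c) * ((n : ℝ) + 1)⁻¹) := by
      intro n
      -- At this time the standard deviation is `n + 1`, so the Gaussian density is at most `1 /
      -- (√(2π) (n + 1))`, and the mass of `[-c, c]` tends to zero.
      set t : ℝ≥0 := ((n : ℝ≥0) + 1) ^ 2 with ht
      have ht0 : t ≠ 0 := by positivity
      have hl := hB.hasLaw_increment 0 t zero_le
      rw [tsub_zero] at hl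
      refine (measure_mono (Set.iInter_subset _ t)).trans ?_
      have hm : MeasurableSet {x : ℝ | |x| ≤ c} := measurableSet_le measurable_id.abs measurable_const
      rw [hl.measure_eq (p := fun x => |x| ≤ c) hm, gaussianReal_apply _ ht0]
      have hpdf : ∀ x, gaussianPDF 0 t x
          ≤ ENNReal.ofReal ((√(2 * Real.pi))⁻¹ * ((n : ℝ) + 1)⁻¹) := by
        intro x
        refine ENNReal.ofReal_le_ofReal ?_
        rw [gaussianPDFReal]
        have hs : √(2 * Real.pi * t) = √(2 * Real.pi) * ((n : ℝ) + 1) := by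
          rw [Real.sqrt_mul (by positivity), ht]
          push_cast
          rw [Real.sqrt_sq (by positivity)]
        rw [hs, mul_inv]
        refine mul_le_of_le_one_right (by positivity) (Real.exp_le_one_iff.2 ?_)
        rw [neg_div]
        exact neg_nonpos.2 (by positivity)
      refine (lintegral_mono hpdf).trans ?_
      have hset : {x : ℝ | |x| ≤ c} = Set.Icc (-(c : ℝ)) c := by ext x; simp [abs_le]
      rw [setLIntegral_const, hset, Real.volume_Icc, ← ENNReal.ofReal_mul (by positivity)]
      refine ENNReal.ofReal_le_ofReal (le_of_eq ?_)
      ring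
    have hlim : Tendsto (fun n : ℕ => ENNReal.ofReal
        ((√(2 * Real.pi))⁻¹ * (2 * c) * ((n : ℝ) + 1)⁻¹)) atTop (𝓝 0) := by
      have := (tendsto_one_div_add_atTop_nhds_zero_nat (𝕜 := ℝ)).const_mul
        ((√(2 * Real.pi))⁻¹ * (2 * c))
      simpa using ENNReal.tendsto_ofReal this
    exact le_antisymm (ge_of_tendsto' hlim hle) zero_le
  rw [ae_iff]
  refine measure_mono_null ?_ (measure_iUnion_null key)
  intro ω hω
  have htop : exitTime B Td Tu ω = ⊤ := by simpa using hω
  obtain ⟨c, hc⟩ := exists_nat_ge (max (Tu (B 0 ω) - B 0 ω) (B 0 ω - Td (B 0 ω)))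
  refine Set.mem_iUnion.2 ⟨c, Set.mem_iInter.2 fun t => ?_⟩
  have := mem_Icc_of_le_exitTime hB.continuous_paths hd hu
    (ω := ω) (t := t) (by rw [htop]; exact le_top)
  have h1 := le_max_left (Tu (B 0 ω) - B 0 ω) (B 0 ω - Td (B 0 ω))
  have h2 := le_max_right (Tu (B 0 ω) - B 0 ω) (B 0 ω - Td (B 0 ω))
  have h3 := this.1
  have h4 := this.2
  change |B t ω - B 0 ω| ≤ c
  rw [abs_le]
  constructor <;> linarith

end Brownian

/-! ### Truncated times, and optional sampling up to the exit time. -/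

section Stopped

variable {Ω : Type*} {m : MeasurableSpace Ω} {P : Measure Ω}
  {𝓕 : Filtration ℝ≥0 m} {B : ℝ≥0 → Ω → ℝ} {μ ν : Measure ℝ} {Td Tu : ℝ → ℝ}
  {σ τ : Ω → WithTop ℝ≥0}

/-- The time `τ ∧ N` as a real-valued time. -/
noncomputable def truncTime (τ : Ω → WithTop ℝ≥0) (N : ℝ≥0) (ω : Ω) : ℝ≥0 :=
  (min (τ ω) N).untopA

lemma coe_truncTime (τ : Ω → WithTop ℝ≥0) (N : ℝ≥0) (ω : Ω) :
    (truncTime τ N ω : WithTop ℝ≥0) = min (τ ω) N := by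
  have h : min (τ ω) (N : WithTop ℝ≥0) ≠ ⊤ :=
    ((min_le_right _ _).trans_lt (WithTop.coe_lt_top N)).ne
  rw [truncTime, WithTop.untopA_eq_untop h, WithTop.coe_untop]

lemma truncTime_le (τ : Ω → WithTop ℝ≥0) (N : ℝ≥0) (ω : Ω) : truncTime τ N ω ≤ N := by
  rw [← WithTop.coe_le_coe, coe_truncTime]
  exact min_le_right _ _

lemma truncTime_mono (h : ∀ ω, σ ω ≤ τ ω) (N : ℝ≥0) (ω : Ω) :
    truncTime σ N ω ≤ truncTime τ N ω := by
  rw [← WithTop.coe_le_coe, coe_truncTime, coe_truncTime]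
  exact min_le_min_right _ (h ω)

lemma truncTime_coe_of_eq {ω : Ω} {t : ℝ≥0} (h : τ ω = t) (N : ℝ≥0) :
    truncTime τ N ω = min t N := by
  rw [← WithTop.coe_inj, coe_truncTime, h, WithTop.coe_min]

/-- The difference is the length of the part of `[σ, τ]` lying in `[0, N]`. -/
lemma truncTime_sub_truncTime_mono {ω : Ω} (h : σ ω ≤ τ ω) {N N' : ℝ≥0} (hN : N ≤ N') :
    (truncTime τ N ω : ℝ) - truncTime σ N ω ≤ truncTime τ N' ω - truncTime σ N' ω := by
  have hN' : (N : WithTop ℝ≥0) ≤ N' := WithTop.coe_le_coe.2 hN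
  rcases le_total (σ ω) N with h1 | h1
  · have e : truncTime σ N ω = truncTime σ N' ω := by
      rw [← WithTop.coe_inj, coe_truncTime, coe_truncTime, min_eq_left h1,
        min_eq_left (h1.trans hN')]
    have l : truncTime τ N ω ≤ truncTime τ N' ω := by
      rw [← WithTop.coe_le_coe, coe_truncTime, coe_truncTime]
      exact min_le_min_left _ hN'
    rw [e]
    exact sub_le_sub_right (NNReal.coe_le_coe.2 l) _
  · have e : truncTime σ N ω = truncTime τ N ω := by
      rw [← WithTop.coe_inj, coe_truncTime, coe_truncTime, min_eq_right h1,
        min_eq_right (h1.trans h)]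
    have l : truncTime σ N' ω ≤ truncTime τ N' ω := by
      rw [← WithTop.coe_le_coe, coe_truncTime, coe_truncTime]
      exact min_le_min_right _ h
    rw [e, sub_self]
    exact sub_nonneg.2 (NNReal.coe_le_coe.2 l)

lemma eventually_truncTime_eq {ω : Ω} (h : τ ω ≠ ⊤) :
    ∀ᶠ N : ℕ in atTop, truncTime τ N ω = (τ ω).untopA := by
  obtain ⟨t, ht⟩ := WithTop.ne_top_iff_exists.1 h
  filter_upwards [(tendsto_natCast_atTop_atTop (R := ℝ≥0)).eventually_ge_atTop t] with N hN
  rw [truncTime_coe_of_eq ht.symm, min_eq_left hN, ← ht]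
  rfl

lemma measurableSet_truncTime_lt (hτ : IsStoppingTime 𝓕.rightCont τ) (N t : ℝ≥0) :
    MeasurableSet[𝓕 t] {ω | truncTime τ N ω < t} := by
  have h : {ω | truncTime τ N ω < t} = {ω | τ ω < t} ∪ {_ω : Ω | N < t} := by
    ext ω
    simp only [Set.mem_ofPred_eq, Set.mem_union]
    rw [← WithTop.coe_lt_coe, coe_truncTime, min_lt_iff, WithTop.coe_lt_coe]
  rw [h]
  exact (measurableSet_lt_of_rightCont hτ t).union (MeasurableSet.const _)

lemma measurable_stoppedValue_of_rightCont {G : ℝ≥0 → Ω → ℝ} (hG : StronglyAdapted 𝓕 G)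
    (hGc : ∀ ω, Continuous fun t => G t ω) (hτ : IsStoppingTime 𝓕.rightCont τ) :
    Measurable (stoppedValue G τ) := by
  have hG' : StronglyAdapted 𝓕.rightCont G := fun t => (hG t).mono (𝓕.le_rightCont t)
  exact (measurable_stoppedValue (hG'.isStronglyProgressive_of_continuous hGc) hτ).mono
    hτ.measurableSpace_le le_rfl

lemma measurable_truncTime_comp {G : ℝ≥0 → Ω → ℝ} (hG : StronglyAdapted 𝓕 G)
    (hGc : ∀ ω, Continuous fun t => G t ω) (hτ : IsStoppingTime 𝓕.rightCont τ) (N : ℝ≥0) :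
    Measurable (fun ω => G (truncTime τ N ω) ω) :=
  measurable_stoppedValue_of_rightCont hG hGc (hτ.min_const N)

lemma abs_sub_le_of_le_exitTime (hc : ∀ ω, Continuous fun t => B t ω) (hd : ∀ x, Td x ≤ x)
    (hu : ∀ x, x ≤ Tu x) {ω : Ω} {s t : ℝ≥0} (hs : (s : WithTop ℝ≥0) ≤ exitTime B Td Tu ω)
    (ht : (t : WithTop ℝ≥0) ≤ exitTime B Td Tu ω) :
    |B t ω - B s ω| ≤ Tu (B 0 ω) - Td (B 0 ω) := by
  have h1 := mem_Icc_of_le_exitTime hc hd hu hs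
  have h2 := mem_Icc_of_le_exitTime hc hd hu ht
  exact abs_sub_le_of_le_of_le h2.1 h2.2 h1.1 h1.2

variable [IsProbabilityMeasure P]

/-- Optional sampling up to the exit time, tested against a process which vanishes unless the
interval has bounded length. -/
theorem integral_mul_stoppedValue_sub (hB : IsBrownianFrom 𝓕 B μ P) (hTd : Measurable Td)
    (hTu : Measurable Tu) (hd : ∀ x, Td x ≤ x) (hu : ∀ x, x ≤ Tu x)
    (hσ : IsStoppingTime 𝓕.rightCont σ) (hle : ∀ ω, σ ω ≤ exitTime B Td Tu ω)
    {G : ℝ≥0 → Ω → ℝ} (hG : StronglyAdapted 𝓕 G) (hGc : ∀ ω, Continuous fun t => G t ω)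
    {C c : ℝ} (hGC : ∀ t ω, |G t ω| ≤ C)
    (hGc' : ∀ t ω, G t ω ≠ 0 → Tu (B 0 ω) - Td (B 0 ω) ≤ c) :
    ∫ ω, stoppedValue G σ ω *
      (stoppedValue B (exitTime B Td Tu) ω - stoppedValue B σ ω) ∂P = 0 := by
  set τ := exitTime B Td Tu
  have hτ := isStoppingTime_exitTime hB hTd hTu
  have hBc := hB.continuous_paths
  have hz : ∀ N : ℕ, ∫ ω, G (truncTime σ N ω) ω *
      (B (truncTime τ N ω) ω - B (truncTime σ N ω) ω) ∂P = 0 := by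
    intro N
    have := integral_mul_sub_eq_zero hB.martingale_sub_zero hB.continuous_sub_zero hG hGc hGC
      (measurableSet_truncTime_lt hσ N) (measurableSet_truncTime_lt hτ N)
      (truncTime_mono hle N) (truncTime_le τ N)
    simpa using this
  have hlim : Tendsto (fun N : ℕ => ∫ ω, G (truncTime σ N ω) ω *
      (B (truncTime τ N ω) ω - B (truncTime σ N ω) ω) ∂P) atTop
      (𝓝 (∫ ω, stoppedValue G σ ω * (stoppedValue B τ ω - stoppedValue B σ ω) ∂P)) := by
    -- Where `G` is nonzero, both values lie in one interval of length at most `c`; this supplies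
    -- the constant dominating function.
    refine tendsto_integral_of_dominated_convergence (fun _ => C * |c|) (fun N => ?_)
      (integrable_const _) (fun N => Eventually.of_forall fun ω => ?_) ?_
    · exact ((measurable_truncTime_comp hG hGc hσ N).mul
        ((measurable_truncTime_comp hB.adapted hBc hτ N).sub
          (measurable_truncTime_comp hB.adapted hBc hσ N))).aestronglyMeasurable
    · have hC : 0 ≤ C := (abs_nonneg _).trans (hGC 0 ω)
      rcases eq_or_ne (G (truncTime σ N ω) ω) 0 with h0 | h0
      · rw [h0, zero_mul, norm_zero]
        positivity
      · rw [Real.norm_eq_abs, abs_mul]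
        refine mul_le_mul (hGC _ _) (le_trans ?_ ((hGc' _ _ h0).trans (le_abs_self c)))
          (abs_nonneg _) hC
        refine abs_sub_le_of_le_exitTime hBc hd hu ?_ ?_
        · rw [coe_truncTime]
          exact (min_le_left _ _).trans (hle ω)
        · rw [coe_truncTime]
          exact min_le_left _ _
    · filter_upwards [ae_exitTime_ne_top hB hd hu] with ω hω
      refine tendsto_const_nhds.congr' ?_
      filter_upwards [eventually_truncTime_eq hω,
        eventually_truncTime_eq (ne_top_of_le_ne_top hω (hle ω))] with N h1 h2
      rw [h1, h2]
      rfl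
  exact tendsto_nhds_unique hlim (by simp [hz])

/-- On an initial event on which the interval has bounded length, an earlier stopping time at which
the Brownian motion takes the same value as at the exit time agrees with the exit time. -/
theorem ae_eq_exitTime_of_stoppedValue_eq (hB : IsBrownianFrom 𝓕 B μ P) (hTd : Measurable Td)
    (hTu : Measurable Tu) (hd : ∀ x, Td x ≤ x) (hu : ∀ x, x ≤ Tu x)
    (hσ : IsStoppingTime 𝓕.rightCont σ) (hle : ∀ ω, σ ω ≤ exitTime B Td Tu ω)
    (heq : ∀ᵐ ω ∂P, stoppedValue B σ ω = stoppedValue B (exitTime B Td Tu) ω) (c : ℝ) :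
    ∀ᵐ ω ∂P, Tu (B 0 ω) - Td (B 0 ω) ≤ c → σ ω = exitTime B Td Tu ω := by
  set τ := exitTime B Td Tu
  have hτ := isStoppingTime_exitTime hB hTd hTu
  have hBc := hB.continuous_paths
  set E : Set ℝ := {x | Tu x - Td x ≤ c} with hE
  have hEm : MeasurableSet E := measurableSet_le (hTu.sub hTd) measurable_const
  set g : Ω → ℝ := fun ω => E.indicator (fun _ => 1) (B 0 ω) with hg
  have hgm : StronglyMeasurable[𝓕 0] g :=
    ((measurable_const.indicator hEm).comp (hB.adapted 0).measurable).stronglyMeasurable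
  have hg01 : ∀ ω, g ω = 0 ∨ g ω = 1 := fun ω => by
    simp only [hg, Set.indicator_apply]; split_ifs <;> simp
  have hgabs : ∀ ω, |g ω| ≤ 1 := fun ω => by rcases hg01 ω with h | h <;> simp [h]
  have hgnn : ∀ ω, 0 ≤ g ω := fun ω => by rcases hg01 ω with h | h <;> simp [h]
  have hgE : ∀ ω, g ω ≠ 0 → Tu (B 0 ω) - Td (B 0 ω) ≤ c := fun ω h => by
    by_contra hcon
    exact h (Set.indicator_of_notMem (s := E) hcon _)
  have hgm' : Measurable g := hgm.measurable.mono (𝓕.le 0) le_rfl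
  set tτ : ℕ → Ω → ℝ := fun N ω => (truncTime τ N ω : ℝ) with htτ
  set tσ : ℕ → Ω → ℝ := fun N ω => (truncTime σ N ω : ℝ) with htσ
  have hid : StronglyAdapted 𝓕 (fun (t : ℝ≥0) (_ : Ω) => (t : ℝ)) := fun t =>
    stronglyMeasurable_const
  have mτ : ∀ N, Measurable (tτ N) := fun N =>
    measurable_truncTime_comp hid (fun _ => NNReal.continuous_coe) hτ N
  have mσ : ∀ N, Measurable (tσ N) := fun N =>
    measurable_truncTime_comp hid (fun _ => NNReal.continuous_coe) hσ N
  have hsτ : ∀ N ω, tσ N ω ≤ tτ N ω := fun N ω => truncTime_mono hle N ω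
  set Wτ : ℕ → Ω → ℝ := fun N ω => (B (truncTime τ N ω) ω - B 0 ω) ^ 2 with hWτ
  set Wσ : ℕ → Ω → ℝ := fun N ω => (B (truncTime σ N ω) ω - B 0 ω) ^ 2 with hWσ
  have mWτ : ∀ N, Measurable (Wτ N) := fun N =>
    ((measurable_truncTime_comp hB.adapted hBc hτ N).sub (hB.measurable 0)).pow_const 2
  have mWσ : ∀ N, Measurable (Wσ N) := fun N =>
    ((measurable_truncTime_comp hB.adapted hBc hσ N).sub (hB.measurable 0)).pow_const 2
  -- Where `g` is nonzero, both squared displacements lie in `[0, c ^ 2]`.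
  have bW : ∀ N ω, |g ω * (Wτ N ω - Wσ N ω)| ≤ c ^ 2 := by
    intro N ω
    rcases hg01 ω with h | h
    · rw [h, zero_mul, abs_zero]; positivity
    have hcω := hgE ω (by rw [h]; exact one_ne_zero)
    have b : ∀ t : ℝ≥0, (t : WithTop ℝ≥0) ≤ τ ω → (B t ω - B 0 ω) ^ 2 ≤ c ^ 2 := fun t ht => by
      rw [← sq_abs (B t ω - B 0 ω)]
      exact pow_le_pow_left₀ (abs_nonneg _) ((abs_sub_le_of_le_exitTime hBc hd hu
        (by exact_mod_cast zero_le) ht).trans hcω) 2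
    have b1 := b (truncTime τ N ω) (by rw [coe_truncTime]; exact min_le_left _ _)
    have b2 := b (truncTime σ N ω) (by rw [coe_truncTime]; exact (min_le_left _ _).trans (hle ω))
    rw [h, one_mul]
    exact abs_sub_le_of_nonneg_of_le (sq_nonneg _) b1 (sq_nonneg _) b2
  have iW : ∀ N, Integrable (fun ω => g ω * (Wτ N ω - Wσ N ω)) P := fun N =>
    Integrable.of_bound (hgm'.mul ((mWτ N).sub (mWσ N))).aestronglyMeasurable (c ^ 2)
      (Eventually.of_forall (bW N))
  have iT : ∀ N, Integrable (fun ω => g ω * (tτ N ω - tσ N ω)) P := fun N => by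
    refine Integrable.of_bound (hgm'.mul ((mτ N).sub (mσ N))).aestronglyMeasurable (N : ℝ)
      (Eventually.of_forall fun ω => ?_)
    have h1 : tτ N ω ≤ N := by exact_mod_cast truncTime_le τ N ω
    have h2 : 0 ≤ tσ N ω := NNReal.coe_nonneg _
    have h3 := hsτ N ω
    rw [Real.norm_eq_abs, abs_mul, abs_of_nonneg (sub_nonneg.2 h3)]
    calc |g ω| * (tτ N ω - tσ N ω) ≤ 1 * (tτ N ω - tσ N ω) :=
          mul_le_mul_of_nonneg_right (hgabs ω) (sub_nonneg.2 h3)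
      _ ≤ N := by linarith
  -- Optional sampling for `(B_t - B_0) ^ 2 - t`, tested against the time-zero indicator `g`.
  have hval : ∀ N, ∫ ω, g ω * (tτ N ω - tσ N ω) ∂P = ∫ ω, g ω * (Wτ N ω - Wσ N ω) ∂P := by
    intro N
    have h := integral_mul_sub_eq_zero (G := fun _ => g) hB.martingale_sq_sub
      (fun ω => ((hB.continuous_sub_zero ω).pow 2).sub NNReal.continuous_coe)
      (fun t => hgm.mono (𝓕.mono zero_le)) (fun _ => continuous_const) (C := 1)
      (fun _ => hgabs) (measurableSet_truncTime_lt hσ N) (measurableSet_truncTime_lt hτ N)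
      (truncTime_mono hle N) (truncTime_le τ N)
    have e : ∀ ω, g ω * ((B (truncTime τ N ω) ω - B 0 ω) ^ 2 - (truncTime τ N ω : ℝ)
        - ((B (truncTime σ N ω) ω - B 0 ω) ^ 2 - (truncTime σ N ω : ℝ)))
        = g ω * (Wτ N ω - Wσ N ω) - g ω * (tτ N ω - tσ N ω) := fun ω => by
      simp only [hWτ, hWσ, htτ, htσ]; ring
    rw [integral_congr_ae (Eventually.of_forall e), integral_sub (iW N) (iT N)] at h
    linarith
  -- Once `N` exceeds both times, the two values of `B` agree, so the integrand on the right of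
  -- `hval` is eventually zero.
  have hlim : Tendsto (fun N => ∫ ω, g ω * (tτ N ω - tσ N ω) ∂P) atTop (𝓝 0) := by
    refine Tendsto.congr (fun N => (hval N).symm) ?_
    rw [← integral_zero Ω ℝ (μ := P)]
    refine tendsto_integral_of_dominated_convergence (fun _ => c ^ 2)
      (fun N => (iW N).aestronglyMeasurable) (integrable_const _)
      (fun N => Eventually.of_forall (bW N)) ?_
    filter_upwards [ae_exitTime_ne_top hB hd hu, heq] with ω hω heqω
    refine tendsto_const_nhds.congr' ?_
    filter_upwards [eventually_truncTime_eq hω,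
      eventually_truncTime_eq (ne_top_of_le_ne_top hω (hle ω))] with N h1 h2
    have e : B (truncTime τ N ω) ω = B (truncTime σ N ω) ω := by
      rw [h1, h2]
      exact heqω.symm
    simp only [hWτ, hWσ, e, sub_self, mul_zero]
  have hmono : ∀ ω, Monotone fun N => tτ N ω - tσ N ω := fun ω N N' h =>
    truncTime_sub_truncTime_mono (hle ω) (Nat.cast_le.2 h)
  -- These integrals are nonnegative, nondecreasing in `N` and tend to zero, so each of them
  -- vanishes.
  have hzero : ∀ N, ∀ᵐ ω ∂P, g ω * (tτ N ω - tσ N ω) = 0 := by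
    intro N
    have nn : ∀ N, 0 ≤ fun ω => g ω * (tτ N ω - tσ N ω) := fun N ω =>
      mul_nonneg (hgnn ω) (sub_nonneg.2 (hsτ N ω))
    have h0 : ∫ ω, g ω * (tτ N ω - tσ N ω) ∂P = 0 := by
      refine le_antisymm (ge_of_tendsto hlim ?_) (integral_nonneg (nn N))
      filter_upwards [eventually_ge_atTop N] with N' hN'
      exact integral_mono (iT N) (iT N') fun ω =>
        mul_le_mul_of_nonneg_left (hmono ω hN') (hgnn ω)
    exact (integral_eq_zero_iff_of_nonneg (nn N) (iT N)).1 h0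
  filter_upwards [ae_all_iff.2 hzero, ae_exitTime_ne_top hB hd hu] with ω hω hfin hcω
  have hg1 : g ω = 1 := Set.indicator_of_mem (s := E) hcω _
  have hfin' := ne_top_of_le_ne_top hfin (hle ω)
  obtain ⟨N, h1, h2⟩ := ((eventually_truncTime_eq hfin).and (eventually_truncTime_eq hfin')).exists
  have := hω N
  rw [hg1, one_mul, sub_eq_zero] at this
  have h3 : truncTime τ N ω = truncTime σ N ω := NNReal.coe_injective this
  rw [h1, h2, WithTop.untopA_eq_untop hfin, WithTop.untopA_eq_untop hfin'] at h3
  rw [← WithTop.coe_untop _ hfin', ← h3, WithTop.coe_untop]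

end Stopped

/-! ### Joint law of the starting point and the exit point. -/

section Law

variable {Ω : Type*} {m : MeasurableSpace Ω} {P : Measure Ω}
  {𝓕 : Filtration ℝ≥0 m} {B : ℝ≥0 → Ω → ℝ} {μ : Measure ℝ} {Td Tu : ℝ → ℝ}

lemma upWeight_mem_Icc (hd : ∀ x, Td x ≤ x) (hu : ∀ x, x ≤ Tu x) (x : ℝ) :
    upWeight Td Tu x ∈ Set.Icc 0 1 := by
  unfold upWeight
  split_ifs with h
  · have h1 : 0 < Tu x - Td x := sub_pos.2 h
    exact ⟨div_nonneg (sub_nonneg.2 (hd x)) h1.le, (div_le_one h1).2 (by linarith [hu x])⟩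
  · simp

lemma isMarkovKernel_twoPointKernel (hTd : Measurable Td) (hTu : Measurable Tu)
    (hd : ∀ x, Td x ≤ x) (hu : ∀ x, x ≤ Tu x) : IsMarkovKernel (twoPointKernel Td Tu hTd hTu) := by
  refine ⟨fun x => ⟨?_⟩⟩
  have hq := upWeight_mem_Icc hd hu x
  change (ENNReal.ofReal (upWeight Td Tu x) • Measure.dirac (Tu x)
    + ENNReal.ofReal (1 - upWeight Td Tu x) • Measure.dirac (Td x)) Set.univ = 1
  simp only [Measure.coe_add, Measure.coe_smul, Pi.add_apply, Pi.smul_apply, measure_univ,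
    smul_eq_mul, mul_one]
  rw [← ENNReal.ofReal_add hq.1 (sub_nonneg.2 hq.2)]
  simp

/-- The event that the Brownian motion exits the interval at its upper end. -/
def exitUp (B : ℝ≥0 → Ω → ℝ) (Td Tu : ℝ → ℝ) : Set Ω :=
  {ω | stoppedValue B (exitTime B Td Tu) ω = Tu (B 0 ω) ∧ Td (B 0 ω) < Tu (B 0 ω)}

lemma measurable_stoppedValue_exitTime (hB : IsBrownianFrom 𝓕 B μ P) (hTd : Measurable Td)
    (hTu : Measurable Tu) : Measurable (stoppedValue B (exitTime B Td Tu)) :=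
  measurable_stoppedValue_of_rightCont hB.adapted hB.continuous_paths
    (isStoppingTime_exitTime hB hTd hTu)

lemma measurableSet_exitUp (hB : IsBrownianFrom 𝓕 B μ P) (hTd : Measurable Td)
    (hTu : Measurable Tu) : MeasurableSet (exitUp B Td Tu) :=
  (measurableSet_eq_fun (measurable_stoppedValue_exitTime hB hTd hTu)
    (hTu.comp (hB.measurable 0))).inter
    (measurableSet_lt (hTd.comp (hB.measurable 0)) (hTu.comp (hB.measurable 0)))

lemma ae_stoppedValue_exitTime (hB : IsBrownianFrom 𝓕 B μ P) (hd : ∀ x, Td x ≤ x)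
    (hu : ∀ x, x ≤ Tu x) : ∀ᵐ ω ∂P,
      (ω ∈ exitUp B Td Tu → stoppedValue B (exitTime B Td Tu) ω = Tu (B 0 ω)) ∧
      (ω ∉ exitUp B Td Tu → stoppedValue B (exitTime B Td Tu) ω = Td (B 0 ω)) := by
  filter_upwards [ae_exitTime_ne_top hB hd hu] with ω hω
  refine ⟨fun h => h.1, fun h => ?_⟩
  have hτ : exitTime B Td Tu ω = (exitTime B Td Tu ω).untopA := by
    rw [WithTop.untopA_eq_untop hω, WithTop.coe_untop]
  rcases eq_or_eq_of_exitTime_eq hB.continuous_paths hd hu hτ with h1 | h1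
  -- Degenerate intervals are excluded from `exitUp`; there both endpoints coincide.
  · have h2 : ¬ Td (B 0 ω) < Tu (B 0 ω) := fun h3 => h ⟨h1, h3⟩
    have h4 : Tu (B 0 ω) = Td (B 0 ω) :=
      le_antisymm (not_lt.1 h2) ((hd _).trans (hu _))
    exact h1.trans h4
  · exact h1

variable [IsProbabilityMeasure P]

/-- Sample between time zero and the exit with weight `1 / (Tu - Td)` on `E`. For a nondegenerate
interval, the weighted displacement is `1 - q` at the upper end and `-q` at the lower end, that is,
the indicator of `exitUp` minus `q`; its mean is zero. The bounds on the length and its inverse make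
the sampling legitimate. -/
lemma measure_exitUp_inter_of_bounds (hB : IsBrownianFrom 𝓕 B μ P) (hTd : Measurable Td)
    (hTu : Measurable Tu) (hd : ∀ x, Td x ≤ x) (hu : ∀ x, x ≤ Tu x) {E : Set ℝ}
    (hE : MeasurableSet E) {c : ℝ} (hc : 0 ≤ c)
    (hEc : ∀ x ∈ E, Td x < Tu x → (Tu x - Td x)⁻¹ ≤ c ∧ Tu x - Td x ≤ c) :
    P (exitUp B Td Tu ∩ B 0 ⁻¹' E) = ∫⁻ x in E, ENNReal.ofReal (upWeight Td Tu x) ∂μ := by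
  have hdu : ∀ x, Td x ≤ Tu x := fun x => (hd x).trans (hu x)
  have mU := measurableSet_exitUp hB hTd hTu
  -- Since `0⁻¹ = 0`, this weight vanishes on degenerate intervals.
  set g : ℝ → ℝ := E.indicator fun x => (Tu x - Td x)⁻¹ with hg
  have hgm : Measurable g := (hTu.sub hTd).inv.indicator hE
  have hg0 : ∀ x, g x ≠ 0 → x ∈ E ∧ Td x < Tu x := fun x hx => by
    by_cases hxE : x ∈ E
    · refine ⟨hxE, lt_of_le_of_ne (hdu x) fun h => hx ?_⟩
      simp [hg, hxE, h]
    · exact absurd (Set.indicator_of_notMem hxE _) hx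
  have hgc : ∀ x, |g x| ≤ c := fun x => by
    rcases eq_or_ne (g x) 0 with h | h
    · rw [h, abs_zero]; exact hc
    · obtain ⟨h1, h2⟩ := hg0 x h
      have : g x = (Tu x - Td x)⁻¹ := Set.indicator_of_mem h1 _
      rw [this, abs_of_nonneg (inv_nonneg.2 (sub_nonneg.2 h2.le))]
      exact (hEc x h1 h2).1
  have key := integral_mul_stoppedValue_sub hB hTd hTu hd hu
    (σ := fun _ => ((0 : ℝ≥0) : WithTop ℝ≥0)) (isStoppingTime_const _ 0)
    (fun ω => by exact_mod_cast zero_le) (G := fun _ ω => g (B 0 ω))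
    (fun t => (hgm.comp ((hB.adapted 0).measurable.mono (𝓕.mono zero_le) le_rfl)).stronglyMeasurable)
    (fun _ => continuous_const) (fun _ _ => hgc _)
    (fun _ ω h => (hEc _ (hg0 _ h).1 (hg0 _ h).2).2)
  have hae : ∀ᵐ ω ∂P, g (B 0 ω) * (stoppedValue B (exitTime B Td Tu) ω - B 0 ω)
      = (exitUp B Td Tu ∩ B 0 ⁻¹' E).indicator 1 ω
        - (B 0 ⁻¹' E).indicator (fun ω => upWeight Td Tu (B 0 ω)) ω := by
    filter_upwards [ae_stoppedValue_exitTime hB hd hu] with ω hω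
    by_cases hωE : B 0 ω ∈ E
    · have e1 : g (B 0 ω) = (Tu (B 0 ω) - Td (B 0 ω))⁻¹ := Set.indicator_of_mem hωE _
      rw [Set.indicator_of_mem (show ω ∈ B 0 ⁻¹' E from hωE), e1]
      by_cases hlt : Td (B 0 ω) < Tu (B 0 ω)
      · have hne : Tu (B 0 ω) - Td (B 0 ω) ≠ 0 := (sub_pos.2 hlt).ne'
        rw [upWeight, if_pos hlt]
        by_cases hωU : ω ∈ exitUp B Td Tu
        · rw [Set.indicator_of_mem (show ω ∈ exitUp B Td Tu ∩ B 0 ⁻¹' E from ⟨hωU, hωE⟩), hω.1 hωU, Pi.one_apply]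
          field_simp
          ring
        · rw [Set.indicator_of_notMem (fun h => hωU h.1), hω.2 hωU]
          field_simp
          ring
      · rw [upWeight, if_neg hlt, Set.indicator_of_notMem (fun h => hlt h.1.2),
          le_antisymm (hdu _) (not_lt.1 hlt)]
        simp
    · have e1 : g (B 0 ω) = 0 := Set.indicator_of_notMem hωE _
      rw [Set.indicator_of_notMem (show ω ∉ B 0 ⁻¹' E from hωE),
        Set.indicator_of_notMem (fun h => hωE h.2), e1]
      simp
  have mE : MeasurableSet (B 0 ⁻¹' E) := hB.measurable 0 hE
  have hqm : Measurable (upWeight Td Tu) := measurable_upWeight hTd hTu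
  have iq : Integrable (fun ω => upWeight Td Tu (B 0 ω)) P :=
    Integrable.of_bound (hqm.comp (hB.measurable 0)).aestronglyMeasurable 1
      (Eventually.of_forall fun ω => by
        have := upWeight_mem_Icc hd hu (B 0 ω)
        rw [Real.norm_eq_abs, abs_of_nonneg this.1]
        exact this.2)
  have key' : ∫ ω, g (B 0 ω) * (stoppedValue B (exitTime B Td Tu) ω - B 0 ω) ∂P = 0 := key
  have iU : Integrable ((exitUp B Td Tu ∩ B 0 ⁻¹' E).indicator (1 : Ω → ℝ)) P :=
    (integrable_const (1 : ℝ)).indicator (mU.inter mE)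
  rw [integral_congr_ae hae, integral_sub iU
    (iq.indicator mE), integral_indicator_one (mU.inter mE), integral_indicator mE,
    sub_eq_zero] at key'
  have e2 : ∫⁻ x in E, ENNReal.ofReal (upWeight Td Tu x) ∂μ
      = ∫⁻ ω in B 0 ⁻¹' E, ENNReal.ofReal (upWeight Td Tu (B 0 ω)) ∂P := by
    rw [← hB.hasLaw_zero.map_eq, setLIntegral_map hE hqm.ennreal_ofReal (hB.measurable 0)]
  rw [e2, ← ofReal_integral_eq_lintegral_ofReal iq.integrableOn
    (Eventually.of_forall fun ω => (upWeight_mem_Icc hd hu (B 0 ω)).1), ← key',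
    ofReal_measureReal]

/-- The sets on which the interval is degenerate, or has length and inverse length at most `n`,
cover the line; measures agreeing on each set of a countable cover are equal. -/
theorem measure_exitUp_inter (hB : IsBrownianFrom 𝓕 B μ P) (hTd : Measurable Td)
    (hTu : Measurable Tu) (hd : ∀ x, Td x ≤ x) (hu : ∀ x, x ≤ Tu x) {E : Set ℝ}
    (hE : MeasurableSet E) :
    P (exitUp B Td Tu ∩ B 0 ⁻¹' E) = ∫⁻ x in E, ENNReal.ofReal (upWeight Td Tu x) ∂μ := by
  set A : ℕ → Set ℝ := fun n => {x | Td x < Tu x → (Tu x - Td x)⁻¹ ≤ n ∧ Tu x - Td x ≤ n} with hA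
  have hAm : ∀ n, MeasurableSet (A n) := fun n =>
    (measurableSet_lt hTd hTu).imp ((measurableSet_le (hTu.sub hTd).inv measurable_const).inter
      (measurableSet_le (hTu.sub hTd) measurable_const))
  have hAu : ⋃ n, A n = Set.univ := by
    refine Set.eq_univ_of_forall fun x => Set.mem_iUnion.2 ?_
    obtain ⟨n, hn⟩ := exists_nat_ge (max (Tu x - Td x)⁻¹ (Tu x - Td x))
    exact ⟨n, fun _ => ⟨(le_max_left _ _).trans hn, (le_max_right _ _).trans hn⟩⟩
  have mU := measurableSet_exitUp hB hTd hTu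
  have heq : (P.restrict (exitUp B Td Tu)).map (B 0)
      = μ.withDensity fun x => ENNReal.ofReal (upWeight Td Tu x) := by
    refine (Measure.ext_iff_of_iUnion_eq_univ hAu).2 fun n => Measure.ext fun s hs => ?_
    have hm := hs.inter (hAm n)
    rw [Measure.restrict_apply hs, Measure.restrict_apply hs,
      Measure.map_apply (hB.measurable 0) hm, Measure.restrict_apply (hB.measurable 0 hm),
      withDensity_apply _ hm, Set.inter_comm]
    exact measure_exitUp_inter_of_bounds hB hTd hTu hd hu hm n.cast_nonneg fun x hx => hx.2
  have h := congrArg (fun ρ : Measure ℝ => ρ E) heq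
  simp only [Measure.map_apply (hB.measurable 0) hE, Measure.restrict_apply (hB.measurable 0 hE),
    withDensity_apply _ hE] at h
  rw [Set.inter_comm, h]

lemma measure_compl_exitUp_inter [IsFiniteMeasure μ] (hB : IsBrownianFrom 𝓕 B μ P)
    (hTd : Measurable Td) (hTu : Measurable Tu) (hd : ∀ x, Td x ≤ x) (hu : ∀ x, x ≤ Tu x)
    {E : Set ℝ} (hE : MeasurableSet E) :
    P ((exitUp B Td Tu)ᶜ ∩ B 0 ⁻¹' E)
      = ∫⁻ x in E, ENNReal.ofReal (1 - upWeight Td Tu x) ∂μ := by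
  have mU := measurableSet_exitUp hB hTd hTu
  have h1 : P (exitUp B Td Tu ∩ B 0 ⁻¹' E) + P ((exitUp B Td Tu)ᶜ ∩ B 0 ⁻¹' E) = μ E := by
    rw [← hB.hasLaw_zero.map_eq, Measure.map_apply (hB.measurable 0) hE,
      Set.inter_comm, Set.inter_comm _ (B 0 ⁻¹' E), ← Set.sdiff_eq, measure_inter_add_sdiff _ mU]
  have h2 : ∫⁻ x in E, ENNReal.ofReal (upWeight Td Tu x) ∂μ
      + ∫⁻ x in E, ENNReal.ofReal (1 - upWeight Td Tu x) ∂μ = μ E := by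
    rw [← lintegral_add_left (measurable_upWeight hTd hTu).ennreal_ofReal, ← setLIntegral_one]
    refine lintegral_congr fun x => ?_
    have hq := upWeight_mem_Icc hd hu x
    rw [← ENNReal.ofReal_add hq.1 (sub_nonneg.2 hq.2)]
    simp
  rw [measure_exitUp_inter hB hTd hTu hd hu hE] at h1
  have hfin : ∫⁻ x in E, ENNReal.ofReal (upWeight Td Tu x) ∂μ ≠ ⊤ :=
    ne_top_of_le_ne_top (measure_ne_top μ E) (h1 ▸ le_self_add)
  exact (ENNReal.add_right_inj hfin).1 (h1.trans h2.symm)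

/-- The starting point and the exit point have the joint law given by the two-point kernel. -/
theorem hasLaw_exit [IsFiniteMeasure μ] (hB : IsBrownianFrom 𝓕 B μ P) (hTd : Measurable Td)
    (hTu : Measurable Tu) (hd : ∀ x, Td x ≤ x) (hu : ∀ x, x ≤ Tu x) :
    HasLaw (fun ω => (B 0 ω, stoppedValue B (exitTime B Td Tu) ω))
      (μ ⊗ₘ twoPointKernel Td Tu hTd hTu) P := by
  have hm : Measurable (fun ω => (B 0 ω, stoppedValue B (exitTime B Td Tu) ω)) :=
    (hB.measurable 0).prodMk (measurable_stoppedValue_exitTime hB hTd hTu)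
  have mU := measurableSet_exitUp hB hTd hTu
  have hq := measurable_upWeight hTd hTu
  have := isMarkovKernel_twoPointKernel hTd hTu hd hu
  have := Measure.isProbabilityMeasure_map (μ := P) hm.aemeasurable
  refine ⟨hm.aemeasurable, Measure.ext_prod fun {C D} hC hD => ?_⟩
  rw [Measure.map_apply hm (hC.prod hD), Measure.compProd_apply_prod hC hD]
  have e1 : ∀ x, twoPointKernel Td Tu hTd hTu x D
      = (Tu ⁻¹' D).indicator (fun x => ENNReal.ofReal (upWeight Td Tu x)) x
        + (Td ⁻¹' D).indicator (fun x => ENNReal.ofReal (1 - upWeight Td Tu x)) x := by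
    intro x
    change (ENNReal.ofReal (upWeight Td Tu x) • Measure.dirac (Tu x)
      + ENNReal.ofReal (1 - upWeight Td Tu x) • Measure.dirac (Td x)) D = _
    simp only [Measure.coe_add, Measure.coe_smul, Pi.add_apply, Pi.smul_apply, smul_eq_mul,
      Measure.dirac_apply' _ hD]
    by_cases h1 : Tu x ∈ D <;> by_cases h2 : Td x ∈ D <;> simp [h1, h2]
  simp only [e1]
  rw [lintegral_add_left (hq.ennreal_ofReal.indicator (hTu hD)),
    setLIntegral_indicator (hTu hD), setLIntegral_indicator (hTd hD),
    ← measure_exitUp_inter hB hTd hTu hd hu ((hTu hD).inter hC),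
    ← measure_compl_exitUp_inter hB hTd hTu hd hu ((hTd hD).inter hC),
    ← measure_inter_add_sdiff _ mU]
  -- The two summands are the upper and the lower exit; on each, the exit point is a known function
  -- of `B 0`.
  congr 1
  · refine measure_congr ?_
    filter_upwards [ae_stoppedValue_exitTime hB hd hu] with ω hω
    refine propext ?_
    change ((B 0 ω ∈ C ∧ stoppedValue B (exitTime B Td Tu) ω ∈ D) ∧ ω ∈ exitUp B Td Tu) ↔
      (ω ∈ exitUp B Td Tu ∧ Tu (B 0 ω) ∈ D ∧ B 0 ω ∈ C)
    by_cases hωU : ω ∈ exitUp B Td Tu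
    · rw [hω.1 hωU]; tauto
    · tauto
  · refine measure_congr ?_
    filter_upwards [ae_stoppedValue_exitTime hB hd hu] with ω hω
    refine propext ?_
    change ((B 0 ω ∈ C ∧ stoppedValue B (exitTime B Td Tu) ω ∈ D) ∧ ω ∉ exitUp B Td Tu) ↔
      (ω ∉ exitUp B Td Tu ∧ Td (B 0 ω) ∈ D ∧ B 0 ω ∈ C)
    by_cases hωU : ω ∈ exitUp B Td Tu
    · tauto
    · rw [hω.2 hωU]; tauto

end Law

/-! ### Minimality via a strictly convex function of linear growth. -/

section Minimal

variable {Ω : Type*} {m : MeasurableSpace Ω} {P : Measure Ω} [IsProbabilityMeasure P]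
  {𝓕 : Filtration ℝ≥0 m} {B : ℝ≥0 → Ω → ℝ} {μ ν : Measure ℝ} {Td Tu : ℝ → ℝ}

lemma sqrt_one_add_sq_pos (a : ℝ) : 0 < √(1 + a ^ 2) := Real.sqrt_pos.2 (by positivity)

lemma abs_div_sqrt_one_add_sq_le (a : ℝ) : |a / √(1 + a ^ 2)| ≤ 1 := by
  rw [abs_div, abs_of_pos (sqrt_one_add_sq_pos a), div_le_one (sqrt_one_add_sq_pos a)]
  exact Real.abs_le_sqrt (by linarith)

/-- In this form the tangent inequality becomes Cauchy-Schwarz, `(1 + a * b) ^ 2 ≤ (1 + a ^ 2) * (1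
+ b ^ 2)`, whose defect is `(a - b) ^ 2`. -/
lemma sqrt_one_add_sq_tangent (a b : ℝ) : √(1 + a ^ 2) + a / √(1 + a ^ 2) * (b - a)
    = (1 + a * b) / √(1 + a ^ 2) := by
  have h := sqrt_one_add_sq_pos a
  have h2 : √(1 + a ^ 2) ^ 2 = 1 + a ^ 2 := Real.sq_sqrt (by positivity)
  field_simp
  linear_combination h2

lemma tangent_le_sqrt_one_add_sq (a b : ℝ) :
    √(1 + a ^ 2) + a / √(1 + a ^ 2) * (b - a) ≤ √(1 + b ^ 2) := by
  rw [sqrt_one_add_sq_tangent, div_le_iff₀ (sqrt_one_add_sq_pos a),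
    ← Real.sqrt_mul (by positivity)]
  exact Real.le_sqrt_of_sq_le (by nlinarith [sq_nonneg (a - b)])

lemma eq_of_tangent_eq_sqrt_one_add_sq {a b : ℝ}
    (h : √(1 + a ^ 2) + a / √(1 + a ^ 2) * (b - a) = √(1 + b ^ 2)) : a = b := by
  rw [sqrt_one_add_sq_tangent, div_eq_iff (sqrt_one_add_sq_pos a).ne',
    ← Real.sqrt_mul (by positivity)] at h
  have h2 : (1 + a * b) ^ 2 = (1 + b ^ 2) * (1 + a ^ 2) := by
    rw [h, Real.sq_sqrt (by positivity)]
  have h3 : (a - b) ^ 2 = 0 := by linear_combination -h2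
  exact sub_eq_zero.1 (pow_eq_zero_iff two_ne_zero |>.1 h3)

/-- An earlier stopping time embedding the same integrable law stops at the same point. -/
theorem ae_stoppedValue_eq (hB : IsBrownianFrom 𝓕 B μ P) (hTd : Measurable Td)
    (hTu : Measurable Tu) (hd : ∀ x, Td x ≤ x) (hu : ∀ x, x ≤ Tu x)
    (hν : Integrable (fun y : ℝ => y) ν)
    (hτν : HasLaw (stoppedValue B (exitTime B Td Tu)) ν P) {σ : Ω → WithTop ℝ≥0}
    (hσ : IsStoppingTime 𝓕.rightCont σ) (hle : ∀ ω, σ ω ≤ exitTime B Td Tu ω)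
    (hσν : HasLaw (stoppedValue B σ) ν P) :
    ∀ᵐ ω ∂P, stoppedValue B σ ω = stoppedValue B (exitTime B Td Tu) ω := by
  set X := stoppedValue B σ
  set Y := stoppedValue B (exitTime B Td Tu)
  have iX : Integrable X P := by
    have h := hν
    rw [← hσν.map_eq] at h
    exact (integrable_map_measure aestronglyMeasurable_id hσν.aemeasurable).1 h
  have iY : Integrable Y P := by
    have h := hν
    rw [← hτν.map_eq] at h
    exact (integrable_map_measure aestronglyMeasurable_id hτν.aemeasurable).1 h
  -- Linear growth makes `φ` integrable with only a first moment of `ν`; the derivative `ψ` is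
  -- bounded, as optional sampling requires.
  set φ : ℝ → ℝ := fun y => √(1 + y ^ 2) with hφ
  set ψ : ℝ → ℝ := fun y => y / √(1 + y ^ 2) with hψ
  have hφc : Continuous φ := by fun_prop
  have hψc : Continuous ψ := by
    refine continuous_id.div hφc fun y => (sqrt_one_add_sq_pos y).ne'
  have hφint : ∀ Z : Ω → ℝ, Integrable Z P → Integrable (fun ω => φ (Z ω)) P := by
    intro Z hZ
    refine ((integrable_const (1 : ℝ)).add hZ.abs).mono'
      (hφc.comp_aestronglyMeasurable hZ.aestronglyMeasurable) (Eventually.of_forall fun ω => ?_)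
    rw [Real.norm_eq_abs, abs_of_nonneg (Real.sqrt_nonneg _)]
    refine Real.sqrt_le_iff.2 ⟨by simp only [Pi.add_apply]; positivity, ?_⟩
    simp only [Pi.add_apply]
    nlinarith [sq_abs (Z ω), abs_nonneg (Z ω)]
  have iφX := hφint X iX
  have iφY := hφint Y iY
  have hφeq : ∫ ω, φ (Y ω) ∂P = ∫ ω, φ (X ω) ∂P := by
    have h1 := hτν.integral_comp (f := φ) hφc.aestronglyMeasurable
    have h2 := hσν.integral_comp (f := φ) hφc.aestronglyMeasurable
    exact h1.trans h2.symm
  have iYX : Integrable (fun ω => Y ω - X ω) P := iY.sub iX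
  have hψX : AEStronglyMeasurable (fun ω => ψ (X ω)) P :=
    hψc.comp_aestronglyMeasurable iX.aestronglyMeasurable
  have iψ : Integrable (fun ω => ψ (X ω) * (Y ω - X ω)) P :=
    iYX.bdd_mul hψX (Eventually.of_forall fun ω => abs_div_sqrt_one_add_sq_le _)
  -- Restrict to initial intervals of length at most `n`, then let `n` grow; integrability of `X`
  -- and `Y` gives the domination.
  have hψ0 : ∫ ω, ψ (X ω) * (Y ω - X ω) ∂P = 0 := by
    set A : ℕ → Set ℝ := fun n => {x | Tu x - Td x ≤ n} with hA
    have hAm : ∀ n, MeasurableSet (A n) := fun n =>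
      measurableSet_le (hTu.sub hTd) measurable_const
    have hAi : ∀ n x, |(A n).indicator (fun _ => (1 : ℝ)) x| ≤ 1 := fun n x => by
      rw [Set.indicator_apply]; split_ifs <;> simp
    have hz : ∀ n : ℕ, ∫ ω, (A n).indicator (fun _ => (1 : ℝ)) (B 0 ω) * ψ (X ω)
        * (Y ω - X ω) ∂P = 0 := by
      intro n
      refine integral_mul_stoppedValue_sub hB hTd hTu hd hu hσ hle
        (G := fun t ω => (A n).indicator (fun _ => (1 : ℝ)) (B 0 ω) * ψ (B t ω))
        (fun t => ?_) (fun ω => ?_) (C := 1) (c := n) (fun t ω => ?_) (fun t ω h => ?_)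
      · exact (((measurable_const.indicator (hAm n)).comp
          ((hB.adapted 0).measurable.mono (𝓕.mono zero_le) le_rfl)).mul
          (hψc.measurable.comp (hB.adapted t).measurable)).stronglyMeasurable
      · exact continuous_const.mul (hψc.comp (hB.continuous_paths ω))
      · rw [abs_mul]
        exact mul_le_one₀ (hAi n _) (abs_nonneg _) (abs_div_sqrt_one_add_sq_le _)
      · by_contra hcon
        exact h (by rw [Set.indicator_of_notMem (s := A n) hcon, zero_mul])
    have hlim : Tendsto (fun n : ℕ => ∫ ω, (A n).indicator (fun _ => (1 : ℝ)) (B 0 ω) * ψ (X ω)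
        * (Y ω - X ω) ∂P) atTop (𝓝 (∫ ω, ψ (X ω) * (Y ω - X ω) ∂P)) := by
      refine tendsto_integral_of_dominated_convergence (fun ω => |ψ (X ω) * (Y ω - X ω)|)
        (fun n => ?_) iψ.abs (fun n => Eventually.of_forall fun ω => ?_)
        (Eventually.of_forall fun ω => ?_)
      · exact ((((measurable_const.indicator (hAm n)).comp
          (hB.measurable 0)).aestronglyMeasurable).mul hψX).mul iYX.aestronglyMeasurable
      · rw [mul_assoc, Real.norm_eq_abs, abs_mul]
        exact mul_le_of_le_one_left (abs_nonneg _) (hAi n _)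
      · refine tendsto_const_nhds.congr' ?_
        filter_upwards [(tendsto_natCast_atTop_atTop (R := ℝ)).eventually_ge_atTop
          (Tu (B 0 ω) - Td (B 0 ω))] with n hn
        rw [Set.indicator_of_mem (s := A n) hn, one_mul]
    exact tendsto_nhds_unique hlim (by simp [hz])
  have iφψ : Integrable (fun ω => φ (X ω) + ψ (X ω) * (Y ω - X ω)) P := iφX.add iψ
  have hD : ∫ ω, (φ (Y ω) - (φ (X ω) + ψ (X ω) * (Y ω - X ω))) ∂P = 0 := by
    rw [integral_sub iφY iφψ, integral_add iφX iψ, hφeq, hψ0]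
    simp
  have hD0 := (integral_eq_zero_iff_of_nonneg
    (fun ω => sub_nonneg.2 (tangent_le_sqrt_one_add_sq (X ω) (Y ω)))
    (iφY.sub iφψ)).1 hD
  filter_upwards [hD0] with ω hω
  exact eq_of_tangent_eq_sqrt_one_add_sq (sub_eq_zero.1 hω).symm

theorem isMinimalEmbedding_exitTime (hB : IsBrownianFrom 𝓕 B μ P) (hTd : Measurable Td)
    (hTu : Measurable Tu) (hd : ∀ x, Td x ≤ x) (hu : ∀ x, x ≤ Tu x)
    (hν : Integrable (fun y : ℝ => y) ν)
    (hτν : HasLaw (stoppedValue B (exitTime B Td Tu)) ν P) :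
    IsMinimalEmbedding 𝓕.rightCont B ν P (exitTime B Td Tu) := by
  have hτ := isStoppingTime_exitTime hB hTd hTu
  refine ⟨⟨hτ, ae_exitTime_ne_top hB hd hu, hτν⟩, fun σ hσ hle => ?_⟩
  -- Taking the minimum makes the almost sure inequality hold everywhere without changing `σ` up to
  -- null sets.
  have hmin : (fun ω => min (σ ω) (exitTime B Td Tu ω)) =ᵐ[P] σ := by
    filter_upwards [hle] with ω hω using min_eq_left hω
  have hst := hσ.isStoppingTime.min hτ
  have hlaw : HasLaw (stoppedValue B fun ω => min (σ ω) (exitTime B Td Tu ω)) ν P := by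
    refine hσ.hasLaw.congr ?_
    filter_upwards [hmin] with ω hω
    simp only [stoppedValue, hω]
  have hval := ae_stoppedValue_eq hB hTd hTu hd hu hν hτν hst (fun ω => min_le_right _ _) hlaw
  have heq := fun n : ℕ => ae_eq_exitTime_of_stoppedValue_eq hB hTd hTu hd hu hst
    (fun ω => min_le_right _ _) hval n
  filter_upwards [ae_all_iff.2 heq, hmin] with ω h1 h2
  obtain ⟨n, hn⟩ := exists_nat_ge (Tu (B 0 ω) - Td (B 0 ω))
  exact h2.symm.trans (h1 n hn)

end Minimal

end LeftMonotone

theorem mainTheorem5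
    (μ ν : Measure ℝ) [IsProbabilityMeasure μ] [IsProbabilityMeasure ν] [NullSingletonClass μ]
    (hμ : Integrable (fun x : ℝ => x) μ) (hν : Integrable (fun y : ℝ => y) ν)
    (π : Measure (ℝ × ℝ)) (hπ : LeftMonotone.IsMartingaleCoupling π μ ν)
    (hmono : LeftMonotone.IsLeftMonotone π)
    (Td Tu : ℝ → ℝ) (hT : LeftMonotone.IsTransportPair π μ Td Tu)
    {Ω : Type*} {m : MeasurableSpace Ω} (P : Measure Ω) [IsProbabilityMeasure P]
    (𝓕 : Filtration ℝ≥0 m) (B : ℝ≥0 → Ω → ℝ) (hB : LeftMonotone.IsBrownianFrom 𝓕 B μ P) :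
    HasLaw (fun ω => (B 0 ω, stoppedValue B (LeftMonotone.exitTime B Td Tu) ω)) π P ∧
      LeftMonotone.IsMinimalEmbedding 𝓕.rightCont B ν P (LeftMonotone.exitTime B Td Tu) := by
  obtain ⟨hTd, hTu, hd, hu, -, hπeq⟩ := hT
  have hlaw := LeftMonotone.hasLaw_exit hB hTd hTu hd hu
  rw [← hπeq] at hlaw
  have hsnd : HasLaw (fun z : ℝ × ℝ => z.2) ν π := ⟨measurable_snd.aemeasurable, hπ.snd_eq⟩
  exact ⟨hlaw, LeftMonotone.isMinimalEmbedding_exitTime hB hTd hTu hd hu hν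
    (hsnd.fun_comp hlaw)⟩
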